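/- Let $\mathbb{K}$ be a commutative ring, let $d \ge 1$, and let $n_0,\dots,n_{d-1}$ be nonnegative integers; indices $j$ are taken modulo $d$. For $j=0,\dots,d-1$ let $A_j, D_j \in \mathbb{K}^{n_j\times n_{j+1}}$. For permutations $\sigma_j$ of $\{1,\dots,n_j\}$ and sign vectors $\varepsilon_j\in\{+,-\}^{n_j}$ let $P_j\in\mathbb{K}^{n_j\times n_j}$ be the permutation matrix of $\sigma_j$ and let $Q_j\in\mathbb{K}^{n_j\times n_j}$ be the diagonal matrix with diagonal entries $\pm 1$ given by $\varepsilon_j$. Put $P=(P_0,\dots,P_{d-1})$, $Q=(Q_0,\dots,Q_{d-1})$ and $$M(P,Q)=\prod_{j=0}^{d-1}\Bigl((Q_jP_j)A_j(Q_{j+1}P_{j+1})^{-1}+D_j\Bigr)\in\mathbb{K}^{n_0\times n_0},$$ where all products of matrices are taken in the order $j=0,1,\dots,d-1$. Define $p_i,q_i,r_i\in\mathbb{K}$ for $0\le i\le n_0$ by the identities in $\mathbb{K}[x]$ $$\det\Bigl[xI+\prod_{j=0}^{d-1}A_j\Bigr]=\sum_{i=0}^{n_0}x^{n_0-i}p_i,\qquad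 \det\Bigl[xI+\prod_{j=0}^{d-1}D_j\Bigr]=\sum_{i=0}^{n_0}x^{n_0-i}q_i,\qquad \sum_{P,Q}\det[xI+M(P,Q)]=\sum_{i=0}^{n_0}x^{n_0-i}r_i,$$ where the last sum on the left runs over all choices of the permutations $\sigma_0,\dots,\sigma_{d-1}$ and of the sign vectors $\varepsilon_0,\dots,\varepsilon_{d-1}$ (if $1\neq -1$ in $\mathbb{K}$, this is the sum over all tuples of permutation matrices and of sign matrices). Then for all $0\le k\le n_0$ $$r_k=(1+1)^{\sum_{j=0}^{d-1}n_j}\sum_{i=0}^{k}\left(\prod_{j=0}^{d-1}\frac{(n_j-k+i)!\,(n_j-i)!}{(n_j-k)!}\right)p_i\,q_{k-i},$$ where the factor with index $j$ is an integer if $k\le n_j$ and is read as $0$ if $k>n_j$ (that is, $1/m!=0$ for $m<0$). -/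

import Mathlib

open Polynomial

namespace CyclicSum

/-- The index `m mod d` in the cyclic index set `{0, …, d - 1}`, reached from `0` by `m` successive
steps `j ↦ j + 1 (mod d)`. -/
def idx (d : ℕ) [NeZero d] : ℕ → Fin d
  | 0 => 0
  | m + 1 => idx d m + 1

theorem idx_val (d : ℕ) [NeZero d] (m : ℕ) : (idx d m : ℕ) = m % d := by
  induction m with
  | zero => simp [idx]
  | succ m ih => simp [idx, Fin.val_add, ih]

theorem idx_self (d : ℕ) [NeZero d] : idx d d = 0 := by
  apply Fin.ext
  simp [idx_val]

section

variable {K : Type*} [CommRing K] {d : ℕ} [NeZero d] {n : Fin d → ℕ}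

/-- The ordered product `A₀ A₁ ⋯ A_{m-1}` (indices of the factors mod `d`) of matrices
`A_j` of size `n_j × n_{j+1 mod d}`. -/
def prefixProd (A : ∀ j : Fin d, Matrix (Fin (n j)) (Fin (n (j + 1))) K) :
    (m : ℕ) → Matrix (Fin (n 0)) (Fin (n (idx d m))) K
  | 0 => (1 : Matrix (Fin (n 0)) (Fin (n 0)) K)
  | m + 1 => prefixProd A m * A (idx d m)

/-- The ordered product `A₀ A₁ ⋯ A_{d-1}`, an `n₀ × n₀` matrix. The column index is
transported along the equality `d mod d = 0`. -/
def cyclicProd (A : ∀ j : Fin d, Matrix (Fin (n j)) (Fin (n (j + 1))) K) :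
    Matrix (Fin (n 0)) (Fin (n 0)) K :=
  (prefixProd A d).submatrix id (Fin.cast (congrArg n (idx_self d).symm))

end

section

variable (K : Type*) [CommRing K]

/-- The sign matrix over `K` with diagonal signs `ε`. -/
def signMatrix {m : ℕ} (ε : Fin m → ℤˣ) : Matrix (Fin m) (Fin m) K :=
  Matrix.diagonal fun a => (((ε a : ℤˣ) : ℤ) : K)

/-- The product `Q P` of the sign matrix `Q` of `ε` and the permutation matrix `P` of `σ`. -/
def signedPerm {m : ℕ} (ε : Fin m → ℤˣ) (σ : Equiv.Perm (Fin m)) : Matrix (Fin m) (Fin m) K :=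
  signMatrix K ε * σ.permMatrix K

end

section

variable {K : Type*} [CommRing K] {d : ℕ} [NeZero d] {n : Fin d → ℕ}

/-- `M(P, Q) = ∏_j ((Q_j P_j) A_j (Q_{j+1} P_{j+1})⁻¹ + D_j)`, with `P_j` the permutation matrix of
`σ j` and `Q_j` the sign matrix of `ε j`. -/
noncomputable def twistedProd (A D : ∀ j : Fin d, Matrix (Fin (n j)) (Fin (n (j + 1))) K)
    (σ : ∀ j : Fin d, Equiv.Perm (Fin (n j))) (ε : ∀ j : Fin d, Fin (n j) → ℤˣ) :
    Matrix (Fin (n 0)) (Fin (n 0)) K :=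
  cyclicProd fun j =>
    signedPerm K (ε j) (σ j) * A j * (signedPerm K (ε (j + 1)) (σ (j + 1)))⁻¹ + D j

/-- The polynomial `det[x I + B]` in `K[x]`. -/
noncomputable def detXAdd {m : ℕ} (B : Matrix (Fin m) (Fin m) K) : K[X] :=
  ((X : K[X]) • (1 : Matrix (Fin m) (Fin m) K[X]) + B.map C).det

end

/-- The number `(m - k + i)! (m - i)! / (m - k)!` for `0 ≤ i ≤ k`, where `1 / (m - k)!` is `0` if
`m < k`, as usual for factorials of negative integers. If `k ≤ m` no subtraction is truncated and
the division is exact. -/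
def weight (m k i : ℕ) : ℕ :=
  if k ≤ m then (m - k + i).factorial * (m - i).factorial / (m - k).factorial else 0

end CyclicSum

/-! Cyclic products are linearised on the disjoint union of the index sets. With the blocks `A j` at
`(j, j + 1)` forming one square matrix `M`, and with `y` diagonal, equal to `x` on block 0 and `-1`
elsewhere, `det (y + M)` is, up to a fixed sign, `det (x + A₀ ⋯ A_{d-1})` (`det_blockDiag_add`). The
twisted product then comes from the matrix `U M U⁻¹ + N`, where `N` is built from `D` and `U` is a
block diagonal signed permutation matrix (`blockMatrix_twisted`).

Averaging `det (U M U⁻¹ + y + N)` over signs leaves products of complementary principal minors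
(`sum_det_signs`). Expanding the minors of `y + N` gives terms indexed by a minor of `M` on `U` and
a minor of `N` on `T`, with `T` disjoint from a permuted copy of `U`. Cyclicity forces a set with
nonzero minor to meet every block in the same number of elements (`blockCard_eq`), so each term
depends only on two sizes `i`, `t`, and the permutations achieving disjointness are counted by the
product of weights (`card_perms_disjoint`).

The same minor expansion without averaging identifies `p i` and `q t` with signed sums of minors
(`detXAdd_cyclicProd`); comparing coefficients of `x` finishes the proof. No division in the ring is
needed. -/

namespace CyclicSum

open Matrix Finset

/-! ### Principal minors and averaging over signs -/

section Minors

variable {ι R : Type*} [DecidableEq ι] [CommRing R]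

/-- The principal minor of `A` with rows and columns in `S`. -/
def principalMinor (A : Matrix ι ι R) (S : Finset ι) : R :=
  (A.submatrix (Subtype.val : S → ι) (Subtype.val : S → ι)).det

theorem principalMinor_submatrix {κ : Type*} [DecidableEq κ] (A : Matrix ι ι R) (f : κ ↪ ι)
    (S : Finset κ) :
    principalMinor (A.submatrix f f) S = principalMinor A (S.map f) := by
  unfold principalMinor
  rw [← Matrix.det_submatrix_equiv_self
    (Equiv.ofBijective (fun x : S => (⟨f x, Finset.mem_map_of_mem f x.2⟩ : S.map f))
      ⟨fun x y h => Subtype.ext (f.injective (Subtype.ext_iff.1 h)), fun ⟨y, hy⟩ => by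
        obtain ⟨x, hx, rfl⟩ := Finset.mem_map.1 hy
        exact ⟨⟨x, hx⟩, rfl⟩⟩)]
  rfl

theorem principalMinor_map {R' : Type*} [CommRing R'] (f : R →+* R') (A : Matrix ι ι R)
    (S : Finset ι) : principalMinor (A.map f) S = f (principalMinor A S) := by
  unfold principalMinor
  rw [RingHom.map_det]
  rfl

theorem principalMinor_congr {A B : Matrix ι ι R} {S : Finset ι}
    (h : ∀ a ∈ S, ∀ b ∈ S, A a b = B a b) : principalMinor A S = principalMinor B S := by
  unfold principalMinor
  congr 1
  ext a b
  exact h a a.2 b b.2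

theorem principalMinor_diagonal (y : ι → R) (S : Finset ι) :
    principalMinor (Matrix.diagonal y) S = ∏ i ∈ S, y i := by
  have h : (Matrix.diagonal y).submatrix (Subtype.val : S → ι) Subtype.val =
      Matrix.diagonal fun i : S => y i := by
    ext a b
    rcases eq_or_ne a b with rfl | hab
    · simp
    · simp [hab, Subtype.coe_injective.ne hab]
  unfold principalMinor
  rw [h, Matrix.det_diagonal, Finset.prod_coe_sort]

section

variable [Fintype ι]

theorem det_apply_rows (M : Matrix ι ι R) :
    M.det = ∑ σ : Equiv.Perm ι, ((Equiv.Perm.sign σ : ℤ) : R) * ∏ i, M i (σ i) := by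
  rw [← Matrix.det_transpose, Matrix.det_apply']
  rfl

/-- The matrix whose rows in `S` are those of `A`, the others being those of `D`. -/
def rowMix (A D : Matrix ι ι R) (S : Finset ι) : Matrix ι ι R :=
  Matrix.of fun a b => if a ∈ S then A a b else D a b

theorem det_add_eq_sum_rowMix (A D : Matrix ι ι R) :
    (A + D).det = ∑ S : Finset ι, (rowMix A D S).det := by
  refine ((Matrix.detRowAlternating (R := R) (n := ι)).toMultilinearMap.map_add_univ A D).trans ?_
  refine Finset.sum_congr rfl fun S _ => ?_
  change Matrix.det _ = _
  congr 1
  ext a b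
  by_cases ha : a ∈ S <;> simp [rowMix, Finset.piecewise, ha]

theorem det_eq_mul_principalMinor (M : Matrix ι ι R) (S : Finset ι)
    (h : ∀ a, a ∉ S → ∀ b ∈ S, M a b = 0) :
    M.det = principalMinor M S * principalMinor M Sᶜ := by
  rw [Matrix.twoBlockTriangular_det M (· ∈ S) h]
  unfold principalMinor
  congr 1
  · convert! rfl
  rw [← Matrix.det_submatrix_equiv_self
    (Equiv.subtypeEquivRight (fun x => (Finset.mem_compl (s := S) (a := x)).symm))]
  rfl

/-- Masking the entries between `S` and its complement makes the matrix block diagonal. In the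
Leibniz expansion it keeps exactly the permutations preserving `S`, which are the ones that survive
the sign average. -/
theorem det_blockMask (A D : Matrix ι ι R) (S : Finset ι) :
    (Matrix.of fun a b => if a ∈ S ↔ b ∈ S then rowMix A D S a b else 0).det =
      principalMinor A S * principalMinor D Sᶜ := by
  rw [det_eq_mul_principalMinor _ S (by intro i hi j hj; simp [hi, hj])]
  congr 1 <;> refine principalMinor_congr fun a ha b hb => ?_
  · simp [rowMix, ha, hb]
  · simp only [Finset.mem_compl] at ha hb
    simp [rowMix, ha, hb]

theorem prod_blockMask (A D : Matrix ι ι R) (S : Finset ι) (σ : Equiv.Perm ι) :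
    ∏ i, (if i ∈ S ↔ σ i ∈ S then rowMix A D S i (σ i) else 0) =
      if ∀ i, i ∈ S ↔ σ i ∈ S then ∏ i, rowMix A D S i (σ i) else 0 := by
  split_ifs with h
  · exact Finset.prod_congr rfl fun i _ => by rw [if_pos (h i)]
  · push Not at h
    obtain ⟨i, hi⟩ := h
    refine Finset.prod_eq_zero (Finset.mem_univ i) (if_neg ?_)
    tauto

/-- Orthogonality of sign characters: a sign occurring to an odd power sums to zero, and all powers
are even precisely when `σ` preserves `S`. -/
theorem sum_units_int_signs (S : Finset ι) (σ : Equiv.Perm ι) :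
    ∑ ε : ι → ℤˣ, ∏ i ∈ S, ((((ε i : ℤˣ) : ℤ) : R) * (((ε (σ i) : ℤˣ) : ℤ) : R)) =
      if ∀ i, i ∈ S ↔ σ i ∈ S then 2 ^ Fintype.card ι else 0 := by
  have h1 : ∀ ε : ι → ℤˣ, ∏ i ∈ S, ((((ε i : ℤˣ) : ℤ) : R) * (((ε (σ i) : ℤˣ) : ℤ) : R)) =
      ∏ i, ((if σ i ∈ S then (((ε (σ i) : ℤˣ) : ℤ) : R) else 1) *
        (if i ∈ S then (((ε (σ i) : ℤˣ) : ℤ) : R) else 1)) := by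
    intro ε
    rw [Finset.prod_mul_distrib, Finset.prod_mul_distrib,
      Equiv.prod_comp σ (fun i => if i ∈ S then (((ε i : ℤˣ) : ℤ) : R) else 1)]
    simp [Finset.prod_ite_mem]
  simp_rw [h1]
  -- Replacing `ε` by `ε ∘ σ⁻¹` makes the factor at `i` depend on `ε i` alone, so the sum factors
  -- over `i`.
  rw [← Equiv.sum_comp (Equiv.arrowCongr σ (Equiv.refl ℤˣ))]
  simp only [Equiv.arrowCongr_apply, Equiv.coe_refl, Function.comp_apply, id, Equiv.symm_apply_apply]
  rw [← Fintype.piFinset_univ, ← Finset.prod_univ_sum (fun _ => (Finset.univ : Finset ℤˣ))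
    (fun i (u : ℤˣ) => (if σ i ∈ S then ((u : ℤ) : R) else 1) * (if i ∈ S then ((u : ℤ) : R) else 1))]
  have h2 : ∀ i, ∑ u : ℤˣ, ((if σ i ∈ S then ((u : ℤ) : R) else 1) *
      (if i ∈ S then ((u : ℤ) : R) else 1)) = if i ∈ S ↔ σ i ∈ S then 2 else 0 := by
    intro i
    have hu : (Finset.univ : Finset ℤˣ) = {1, -1} := rfl
    rw [hu, Finset.sum_pair (by decide)]
    by_cases ha : i ∈ S <;> by_cases hb : σ i ∈ S <;> simp [ha, hb] <;> norm_num
  simp_rw [h2]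
  split_ifs with h
  · rw [Finset.prod_congr rfl fun i _ => if_pos (h i)]
    simp
  · push Not at h
    obtain ⟨i, hi⟩ := h
    refine Finset.prod_eq_zero (Finset.mem_univ i) (if_neg ?_)
    tauto

/-- Averaging over conjugations by sign matrices leaves only products of complementary principal
minors. -/
theorem sum_det_signs (A D : Matrix ι ι R) :
    ∑ ε : ι → ℤˣ, (Matrix.of (fun a b =>
      (((ε a : ℤˣ) : ℤ) : R) * (((ε b : ℤˣ) : ℤ) : R) * A a b) + D).det =
      2 ^ Fintype.card ι * ∑ S : Finset ι, principalMinor A S * principalMinor D Sᶜ := by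
  simp_rw [det_add_eq_sum_rowMix, Finset.mul_sum]
  rw [Finset.sum_comm]
  refine Finset.sum_congr rfl fun S _ => ?_
  rw [← det_blockMask, det_apply_rows, Finset.mul_sum]
  simp_rw [det_apply_rows]
  rw [Finset.sum_comm]
  refine Finset.sum_congr rfl fun σ _ => ?_
  have h : ∀ ε : ι → ℤˣ, ∏ i, rowMix (Matrix.of (fun a b =>
      (((ε a : ℤˣ) : ℤ) : R) * (((ε b : ℤˣ) : ℤ) : R) * A a b)) D S i (σ i) =
      (∏ i ∈ S, ((((ε i : ℤˣ) : ℤ) : R) * (((ε (σ i) : ℤˣ) : ℤ) : R))) *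
        ∏ i, rowMix A D S i (σ i) := by
    intro ε
    rw [← Finset.prod_ite_mem_eq S, ← Finset.prod_mul_distrib]
    refine Finset.prod_congr rfl fun i _ => ?_
    by_cases hi : i ∈ S <;> simp [hi, rowMix]
  simp_rw [h]
  rw [← Finset.mul_sum, ← Finset.sum_mul, sum_units_int_signs]
  simp only [Matrix.of_apply]
  rw [prod_blockMask]
  split_ifs
  · ring
  · simp

/-- Rows outside `T` are taken from the diagonal matrix and vanish in the columns of `T`, so each
mixed determinant is block triangular. -/
theorem det_diagonal_add (y : ι → R) (D : Matrix ι ι R) :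
    (Matrix.diagonal y + D).det = ∑ T : Finset ι, principalMinor D T * ∏ i ∈ Tᶜ, y i := by
  rw [add_comm, det_add_eq_sum_rowMix]
  refine Finset.sum_congr rfl fun T _ => ?_
  rw [det_eq_mul_principalMinor _ T, ← principalMinor_diagonal]
  · congr 1 <;> refine principalMinor_congr fun a ha b hb => ?_
    · simp [rowMix, ha]
    · simp only [Finset.mem_compl] at ha
      simp [rowMix, ha]
  · intro i hi j hj
    simp only [rowMix, Matrix.of_apply, if_neg hi]
    exact Matrix.diagonal_apply_ne _ (by rintro rfl; exact hi hj)

end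

theorem principalMinor_diagonal_add (y : ι → R) (D : Matrix ι ι R) (U : Finset ι) :
    principalMinor (Matrix.diagonal y + D) U =
      ∑ T ∈ U.powerset, principalMinor D T * ∏ i ∈ U \ T, y i := by
  have h : (Matrix.diagonal y + D).submatrix (Subtype.val : U → ι) Subtype.val =
      Matrix.diagonal (fun i : U => y i) +
        D.submatrix (Function.Embedding.subtype _) (Function.Embedding.subtype _) := by
    ext a b
    rcases eq_or_ne a b with rfl | hab
    · simp
    · simp [hab, Subtype.coe_injective.ne hab]
  unfold principalMinor
  rw [h, det_diagonal_add]
  simp_rw [principalMinor_submatrix]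
  refine Finset.sum_bij' (fun T _ => T.map (Function.Embedding.subtype _))
    (fun T _ => T.subtype (· ∈ U)) ?_ ?_ ?_ ?_ ?_
  · intro T _
    simp only [Finset.mem_powerset]
    intro a ha
    simp only [Finset.mem_map, Function.Embedding.subtype_apply] at ha
    obtain ⟨b, -, rfl⟩ := ha
    exact b.2
  · intro T _
    exact Finset.mem_univ _
  · intro T _
    ext a
    simp
  · intro T hT
    rw [Finset.subtype_map]
    exact Finset.filter_true_of_mem (Finset.mem_powerset.1 hT)
  · intro T _
    congr 1
    refine (Finset.prod_map Tᶜ (Function.Embedding.subtype _) y).symm.trans ?_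
    congr 1
    ext a
    simp only [Finset.mem_map, Finset.mem_compl, Finset.mem_sdiff, Function.Embedding.subtype_apply]
    constructor
    · rintro ⟨b, hb, rfl⟩
      refine ⟨b.2, ?_⟩
      rintro ⟨c, hc, hcb⟩
      exact hb (Subtype.ext hcb ▸ hc)
    · rintro ⟨ha, hb⟩
      exact ⟨⟨a, ha⟩, fun hc => hb ⟨_, hc, rfl⟩, rfl⟩

end Minors

/-! ### Counting permutations with prescribed image of a set -/

section Counting

variable {α : Type*} [Fintype α] [DecidableEq α]

/-- Such a permutation amounts to a bijection `S ≃ T` together with one between the complements. -/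
theorem card_perm_map_eq (S T : Finset α) (h : S.card = T.card) :
    (Finset.univ.filter fun σ : Equiv.Perm α => S.map σ.toEmbedding = T).card =
      S.card.factorial * (Fintype.card α - S.card).factorial := by
  have key : ∀ σ : Equiv.Perm α, S.map σ.toEmbedding = T ↔ ∀ x, x ∈ S ↔ σ x ∈ T := by
    intro σ
    constructor
    · rintro rfl x
      simp
    · intro hσ
      ext x
      rw [Finset.mem_map_equiv, hσ, Equiv.apply_symm_apply]
  let e : {σ : Equiv.Perm α // S.map σ.toEmbedding = T} ≃
      ({x // x ∈ S} ≃ {x // x ∈ T}) × ({x // ¬ x ∈ S} ≃ {x // ¬ x ∈ T}) :=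
    { toFun := fun σ => (σ.1.subtypeEquiv ((key σ.1).1 σ.2),
        σ.1.subtypeEquiv fun x => not_congr ((key σ.1).1 σ.2 x))
      invFun := fun ef => ⟨Equiv.subtypeCongr ef.1 ef.2, (key _).2 fun x => by
        by_cases hx : x ∈ S
        · simp [Equiv.subtypeCongr, hx]
        · simpa [Equiv.subtypeCongr, hx] using (ef.2 ⟨x, hx⟩).2⟩
      left_inv := fun σ => by
        ext x
        by_cases hx : x ∈ S <;> simp [Equiv.subtypeCongr, hx]
      right_inv := fun ef => by
        ext x
        · simp [Equiv.subtypeCongr]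
        · simp [Equiv.subtypeCongr, x.2] }
  have h1 : Fintype.card {x // x ∈ S} = Fintype.card {x // x ∈ T} := by simpa using h
  have h2 : Fintype.card {x // ¬ x ∈ S} = Fintype.card {x // ¬ x ∈ T} := by
    rw [Fintype.card_subtype_compl, Fintype.card_subtype_compl, h1]
  rw [← Fintype.card_subtype, Fintype.card_congr e, Fintype.card_prod,
    Fintype.card_equiv (Fintype.equivOfCardEq h1), Fintype.card_equiv (Fintype.equivOfCardEq h2),
    Fintype.card_subtype_compl, Fintype.card_coe]

/-- This is the form produced by counting: an image of size `i` is chosen among the `m - t` allowed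
points, then a permutation realising it. For `i + t > m` both sides vanish. -/
theorem weight_eq (m i t : ℕ) (ht : t ≤ m) :
    weight m (i + t) i = i.factorial * (m - i).factorial * (m - t).choose i := by
  unfold weight
  split_ifs with h
  · have h1 : m - (i + t) + i = m - t := by omega
    have h2 : m - t - i = m - (i + t) := by omega
    have h3 := Nat.choose_mul_factorial_mul_factorial (n := m - t) (k := i) (by omega)
    rw [h2] at h3
    rw [h1, ← h3]
    apply Nat.div_eq_of_eq_mul_left (Nat.factorial_pos _)
    ring
  · rw [Nat.choose_eq_zero_of_lt (by omega), mul_zero]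

end Counting

/-! ### Cyclic block matrices and their determinants -/

section Cyclic

variable {R : Type*} [CommRing R] {d : ℕ} [NeZero d] {n : Fin d → ℕ}

theorem idx_val_self (j : Fin d) : idx d j = j :=
  Fin.ext (by rw [idx_val, Nat.mod_eq_of_lt j.2])

/-- Matrices on the disjoint union of the index sets whose only nonzero blocks are those at
`(j, j + 1)`. -/
def IsCyclicBlock (M : Matrix (Σ j, Fin (n j)) (Σ j, Fin (n j)) R) : Prop :=
  ∀ a b, b.1 ≠ a.1 + 1 → M a b = 0

/-- The number of elements of `S` in the block `j`. -/
def blockCard (S : Finset (Σ j, Fin (n j))) (j : Fin d) : ℕ :=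
  (S.filter (·.1 = j)).card

/-- A nonzero Leibniz term gives a permutation of `S` sending block `j` into block `j + 1`; it is
injective. -/
theorem blockCard_le_succ {M : Matrix (Σ j, Fin (n j)) (Σ j, Fin (n j)) R} (hM : IsCyclicBlock M)
    {S : Finset (Σ j, Fin (n j))} (hS : principalMinor M S ≠ 0) (j : Fin d) :
    blockCard S j ≤ blockCard S (j + 1) := by
  unfold principalMinor at hS
  rw [det_apply_rows] at hS
  obtain ⟨π, -, hπ⟩ := Finset.exists_ne_zero_of_sum_ne_zero hS
  have h : ∀ a : S, (π a).1.1 = a.1.1 + 1 := by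
    intro a
    by_contra hne
    exact hπ (by rw [Finset.prod_eq_zero (Finset.mem_univ a) (hM _ _ hne), mul_zero])
  unfold blockCard
  refine Finset.card_le_card_of_injOn
    (fun a => if ha : a ∈ S then (π ⟨a, ha⟩).1 else a) ?_ ?_
  · intro a ha
    simp only [Finset.coe_filter, Set.mem_ofPred_eq] at ha ⊢
    rw [dif_pos ha.1]
    exact ⟨(π _).2, by rw [h, ha.2]⟩
  · intro a ha b hb hab
    simp only [Finset.coe_filter, Set.mem_ofPred_eq] at ha hb
    simp only [dif_pos ha.1, dif_pos hb.1] at hab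
    exact Subtype.ext_iff.1 (π.injective (Subtype.ext hab))

/-- Around the cycle both sides of `blockCard_le_succ` have the same total, so every inequality is
an equality. -/
theorem blockCard_eq {M : Matrix (Σ j, Fin (n j)) (Σ j, Fin (n j)) R} (hM : IsCyclicBlock M)
    {S : Finset (Σ j, Fin (n j))} (hS : principalMinor M S ≠ 0) (j : Fin d) :
    blockCard S j = blockCard S 0 := by
  have h1 : ∀ j, blockCard S j = blockCard S (j + 1) := by
    have := (Finset.sum_eq_sum_iff_of_le (s := Finset.univ)
      fun j _ => blockCard_le_succ hM hS j).1
      (Equiv.sum_comp (Equiv.addRight (1 : Fin d)) (blockCard S)).symm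
    exact fun j => this j (Finset.mem_univ j)
  have h2 : ∀ m, blockCard S (idx d m) = blockCard S 0 := by
    intro m
    induction m with
    | zero => rfl
    | succ m ih => rw [← ih, h1 (idx d m)]; rfl
  rw [← h2 j, idx_val_self]

theorem IsCyclicBlock.pow_apply_eq_zero {M : Matrix (Σ j, Fin (n j)) (Σ j, Fin (n j)) R}
    (hM : IsCyclicBlock M) (m : ℕ) (a b : Σ j, Fin (n j))
    (h : (b.1 : ℕ) ≠ (a.1 + m) % d) : (M ^ m) a b = 0 := by
  induction m generalizing b with
  | zero =>
    rw [pow_zero, Matrix.one_apply_ne]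
    rintro rfl
    exact h (Nat.mod_eq_of_lt a.1.2).symm
  | succ m ih =>
    rw [pow_succ, Matrix.mul_apply]
    refine Finset.sum_eq_zero fun c _ => ?_
    by_cases hc : (c.1 : ℕ) = (a.1 + m) % d
    · rw [hM c b, mul_zero]
      intro hb
      apply h
      rw [hb, Fin.val_add, hc, Fin.val_one', ← Nat.add_mod, add_assoc]
    · rw [ih c hc, zero_mul]

/-- The elements of the block `0`. -/
def zeroBlock (n : Fin d → ℕ) : Finset (Σ j, Fin (n j)) :=
  Finset.univ.filter (·.1 = 0)

theorem zeroBlock_eq_map :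
    zeroBlock n = Finset.univ.map (Function.Embedding.sigmaMk (β := fun j => Fin (n j)) 0) := by
  ext ⟨j, a⟩
  simp only [zeroBlock, Finset.mem_filter, Finset.mem_univ, true_and, Finset.mem_map,
    Function.Embedding.sigmaMk_apply]
  constructor
  · rintro rfl
    exact ⟨a, rfl⟩
  · rintro ⟨b, hb⟩
    exact (congrArg Sigma.fst hb).symm

theorem principalMinor_univ {ι : Type*} [Fintype ι] [DecidableEq ι] (A : Matrix ι ι R) :
    principalMinor A Finset.univ = A.det := by
  unfold principalMinor
  rw [← Matrix.det_submatrix_equiv_self (Equiv.subtypeUnivEquiv (Finset.mem_univ (α := ι))) A]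
  convert! rfl

theorem principalMinor_zeroBlock (A : Matrix (Σ j, Fin (n j)) (Σ j, Fin (n j)) R) :
    principalMinor A (zeroBlock n) = (A.submatrix (Sigma.mk 0) (Sigma.mk 0)).det := by
  rw [zeroBlock_eq_map, ← principalMinor_submatrix, principalMinor_univ]
  rfl

theorem mem_compl_zeroBlock {a : Σ j, Fin (n j)} : a ∈ (zeroBlock n)ᶜ ↔ a.1 ≠ 0 := by
  simp [zeroBlock]

theorem card_filter_fst {d : ℕ} {n : Fin d → ℕ} (j : Fin d) :
    (Finset.univ.filter fun a : Σ j, Fin (n j) => a.1 = j).card = n j := by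
  have h : (Finset.univ.filter fun a : Σ j, Fin (n j) => a.1 = j) =
      Finset.univ.map (Function.Embedding.sigmaMk (β := fun j => Fin (n j)) j) := by
    ext ⟨i, a⟩
    simp only [Finset.mem_filter, Finset.mem_univ, true_and, Finset.mem_map,
      Function.Embedding.sigmaMk_apply]
    constructor
    · rintro rfl
      exact ⟨a, rfl⟩
    · rintro ⟨b, hb⟩
      exact (congrArg Sigma.fst hb).symm
  rw [h]
  simp

/-- The diagonal entries `x` on the block `0` and `-1` elsewhere. -/
def blockDiag (n : Fin d → ℕ) (x : R) (a : Σ j, Fin (n j)) : R :=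
  if a.1 = 0 then x else -1

/-- A set avoiding block 0 with nonzero minor of `M` must be empty by `blockCard_eq`, so only the
diagonal `-1` contributes. -/
theorem principalMinor_compl_zeroBlock {M : Matrix (Σ j, Fin (n j)) (Σ j, Fin (n j)) R}
    (hM : IsCyclicBlock M) :
    principalMinor (M - 1) (zeroBlock n)ᶜ = (-1) ^ (zeroBlock n)ᶜ.card := by
  have h : M - 1 = Matrix.diagonal (fun _ => -1) + M := by
    ext a b
    rcases eq_or_ne a b with rfl | hab
    · simp [sub_eq_neg_add]
    · simp [hab]
  rw [h, principalMinor_diagonal_add, Finset.sum_eq_single ∅]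
  · simp [principalMinor]
  · intro T hT hne
    rw [Finset.mem_powerset] at hT
    by_contra h0
    have h1 := blockCard_eq hM (left_ne_zero_of_mul h0)
    have h2 : blockCard T 0 = 0 := by
      refine Finset.card_eq_zero.2 (Finset.filter_eq_empty_iff.2 fun a ha => ?_)
      exact mem_compl_zeroBlock.1 (hT ha)
    refine hne (Finset.eq_empty_of_forall_notMem fun a ha => ?_)
    have h3 := (h1 a.1).trans h2
    exact Finset.filter_eq_empty_iff.1 (Finset.card_eq_zero.1 h3) ha rfl
  · simp

theorem IsCyclicBlock.pow_apply_zeroBlock {M : Matrix (Σ j, Fin (n j)) (Σ j, Fin (n j)) R}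
    (hM : IsCyclicBlock M) {m : ℕ} (hm : m < d) (hm0 : m ≠ 0) {a b : Σ j, Fin (n j)}
    (ha : a.1 = 0) (hb : b.1 = 0) : (M ^ m) a b = 0 := by
  apply hM.pow_apply_eq_zero
  rw [ha, hb]
  simpa [Nat.mod_eq_of_lt hm] using hm0.symm

theorem IsCyclicBlock.geom_sum_apply_zeroBlock
    {M : Matrix (Σ j, Fin (n j)) (Σ j, Fin (n j)) R}
    (hM : IsCyclicBlock M) {a b : Σ j, Fin (n j)}
    (ha : a.1 = 0) (hb : b.1 = 0) :
    (∑ m ∈ Finset.range d, M ^ m) a b = (1 : Matrix _ _ R) a b := by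
  rw [Matrix.sum_apply, Finset.sum_eq_single_of_mem 0 (Finset.mem_range.2 (NeZero.pos d)), pow_zero]
  intro m hm hm0
  exact hM.pow_apply_zeroBlock (Finset.mem_range.1 hm) hm0 ha hb

/-- The determinant of a cyclic block matrix with diagonal `x, -1, …, -1`. -/
theorem det_blockDiag_add {M : Matrix (Σ j, Fin (n j)) (Σ j, Fin (n j)) R}
    (hM : IsCyclicBlock M) (x : R) :
    (Matrix.diagonal (blockDiag n x) + M).det = (-1) ^ (zeroBlock n)ᶜ.card *
      (x • (1 : Matrix (Fin (n 0)) (Fin (n 0)) R) +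
        (M ^ d).submatrix (Sigma.mk 0) (Sigma.mk 0)).det := by
  -- `F` projects onto block 0. The geometric sum `G` acts as the identity there, since no power `M
  -- ^ m` with `0 < m < d` returns to block 0.
  set F : Matrix (Σ j, Fin (n j)) (Σ j, Fin (n j)) R :=
    Matrix.diagonal fun a => if a.1 = 0 then 1 else 0 with hF
  set G := ∑ m ∈ Finset.range d, M ^ m with hG
  have hFl : ∀ (B : Matrix (Σ j, Fin (n j)) (Σ j, Fin (n j)) R) a b,
      (F * B) a b = if a.1 = 0 then B a b else 0 := by
    intro B a b
    rw [hF, Matrix.diagonal_mul]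
    split_ifs <;> simp
  have hFr : ∀ (B : Matrix (Σ j, Fin (n j)) (Σ j, Fin (n j)) R) a b,
      (B * F) a b = if b.1 = 0 then B a b else 0 := by
    intro B a b
    rw [hF, Matrix.mul_diagonal]
    split_ifs <;> simp
  have hGa : ∀ a b : Σ j, Fin (n j), a.1 = 0 → b.1 = 0 → G a b = (1 : Matrix _ _ R) a b :=
    fun a b ha hb => hM.geom_sum_apply_zeroBlock ha hb
  have hFF : F * F = F := by
    ext a b
    rw [hFl]
    split_ifs with h
    · rfl
    · simp only [hF, Matrix.diagonal_apply, if_neg h, ite_self]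
  have hFGF : F * G * F = F := by
    ext a b
    rw [hFr, hFl]
    by_cases ha : a.1 = 0 <;> by_cases hb : b.1 = 0
    · rw [if_pos hb, if_pos ha, hGa a b ha hb]
      simp [hF, Matrix.diagonal_apply, Matrix.one_apply, ha]
    · have : a ≠ b := by rintro rfl; exact hb ha
      simp [hb, hF, this]
    · simp [ha, hF, Matrix.diagonal_apply]
    · simp [ha, hF, Matrix.diagonal_apply]
  have hY : Matrix.diagonal (blockDiag n x) + M = (M - 1) + (x + 1) • F := by
    ext a b
    rcases eq_or_ne a b with rfl | hab
    · by_cases ha : a.1 = 0 <;> simp [hF, blockDiag, ha] <;> ring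
    · simp [hF, hab]
  -- Block elimination: left multiplication by `(1 - F) + F * G`, of determinant 1, turns the rows
  -- of block 0 into those of `x + M ^ d`, because `G * (M - 1)` telescopes.
  have hprod : ((1 - F) + F * G) * (Matrix.diagonal (blockDiag n x) + M) =
      (1 - F) * (M - 1) + F * (x • 1 + M ^ d) := by
    have h1 : G * (M - 1) = M ^ d - 1 := geom_sum_mul M d
    calc _ = (1 - F) * (M - 1) + F * (G * (M - 1)) +
          (x + 1) • (F - F * F + F * G * F) := by
            rw [hY]
            simp only [mul_add, add_mul, sub_mul, mul_sub, Matrix.mul_smul, smul_add, smul_sub,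
              mul_assoc, one_mul, mul_one]
            abel
      _ = _ := by
            rw [h1, hFF, hFGF, sub_self, zero_add, add_smul, one_smul]
            simp only [mul_add, mul_sub, mul_one, Matrix.mul_smul]
            abel
  have hV : ((1 - F) + F * G).det = 1 := by
    rw [det_eq_mul_principalMinor _ (zeroBlock n)]
    · have h1 : principalMinor ((1 - F) + F * G) (zeroBlock n) = principalMinor 1 (zeroBlock n) := by
        refine principalMinor_congr fun a ha b hb => ?_
        simp only [zeroBlock, Finset.mem_filter, Finset.mem_univ, true_and] at ha hb
        rw [Matrix.add_apply, hFl, if_pos ha, hGa a b ha hb]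
        simp [hF, Matrix.diagonal_apply, Matrix.one_apply, ha]
      have h2 : principalMinor ((1 - F) + F * G) (zeroBlock n)ᶜ =
          principalMinor 1 (zeroBlock n)ᶜ := by
        refine principalMinor_congr fun a ha b hb => ?_
        rw [mem_compl_zeroBlock] at ha
        rw [Matrix.add_apply, hFl, if_neg ha]
        simp [hF, Matrix.diagonal_apply, ha]
      rw [h1, h2, ← Matrix.diagonal_one, principalMinor_diagonal, principalMinor_diagonal]
      simp
    · intro a ha b hb
      rw [← Finset.mem_compl, mem_compl_zeroBlock] at ha
      simp only [zeroBlock, Finset.mem_filter, Finset.mem_univ, true_and] at hb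
      rw [Matrix.add_apply, hFl, if_neg ha]
      have : a ≠ b := by rintro rfl; exact ha hb
      simp [hF, this]
  have h1F : ∀ (B : Matrix (Σ j, Fin (n j)) (Σ j, Fin (n j)) R) a b,
      ((1 - F) * B) a b = if a.1 = 0 then 0 else B a b := by
    intro B a b
    rw [sub_mul, one_mul, Matrix.sub_apply, hFl]
    split_ifs <;> simp
  have hdet := congrArg Matrix.det hprod
  rw [Matrix.det_mul, hV, one_mul] at hdet
  -- The result is block triangular: `M ^ d` has no entries from block 0 to another block.
  rw [hdet,
    det_eq_mul_principalMinor _ (zeroBlock n)ᶜ, compl_compl, ← principalMinor_compl_zeroBlock hM]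
  · congr 1
    · refine principalMinor_congr fun a ha b hb => ?_
      rw [mem_compl_zeroBlock] at ha
      rw [Matrix.add_apply, hFl, h1F, if_neg ha, if_neg ha, add_zero]
    · rw [principalMinor_zeroBlock]
      congr 1
      ext a b
      rw [Matrix.submatrix_apply, Matrix.add_apply, hFl, h1F, if_pos rfl, if_pos rfl, zero_add]
      simp [Matrix.one_apply]
  · intro a ha b hb
    rw [mem_compl_zeroBlock] at hb
    rw [Finset.mem_compl, not_not, zeroBlock, Finset.mem_filter] at ha
    replace ha := ha.2
    have hab : a ≠ b := by rintro rfl; exact hb ha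
    rw [Matrix.add_apply, hFl, h1F, if_pos ha, if_pos ha, zero_add, Matrix.add_apply,
      hM.pow_apply_eq_zero]
    · simp [hab]
    · rw [ha]
      simpa using Fin.val_ne_of_ne hb

/-- The matrix on the disjoint union of the index sets with the blocks `A j` at `(j, j + 1)`. -/
def blockMatrix (A : ∀ j : Fin d, Matrix (Fin (n j)) (Fin (n (j + 1))) R) :
    Matrix (Σ j, Fin (n j)) (Σ j, Fin (n j)) R :=
  Matrix.of fun a b => if h : b.1 = a.1 + 1 then A a.1 a.2 (Fin.cast (congrArg n h) b.2) else 0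

theorem blockMatrix_apply (A : ∀ j : Fin d, Matrix (Fin (n j)) (Fin (n (j + 1))) R) (j : Fin d)
    (a : Fin (n j)) (b : Fin (n (j + 1))) : blockMatrix A ⟨j, a⟩ ⟨j + 1, b⟩ = A j a b := by
  simp [blockMatrix]

theorem isCyclicBlock_blockMatrix (A : ∀ j : Fin d, Matrix (Fin (n j)) (Fin (n (j + 1))) R) :
    IsCyclicBlock (blockMatrix A) := fun _ _ h => dif_neg h

theorem blockMatrix_pow_apply (A : ∀ j : Fin d, Matrix (Fin (n j)) (Fin (n (j + 1))) R) (m : ℕ)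
    (a : Fin (n 0)) (b : Fin (n (idx d m))) :
    (blockMatrix A ^ m) ⟨0, a⟩ ⟨idx d m, b⟩ = prefixProd A m a b := by
  induction m with
  | zero =>
    rw [pow_zero]
    change Fin (n 0) at b
    change (1 : Matrix (Σ j, Fin (n j)) (Σ j, Fin (n j)) R) ⟨0, a⟩ ⟨0, b⟩ =
      (1 : Matrix (Fin (n 0)) (Fin (n 0)) R) a b
    simp [Matrix.one_apply]
  | succ m ih =>
    rw [pow_succ, Matrix.mul_apply, Fintype.sum_sigma, Finset.sum_eq_single (idx d m)]
    · refine Eq.trans ?_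
        (Matrix.mul_apply (M := prefixProd A m) (N := A (idx d m)) (i := a) (k := b)).symm
      refine Finset.sum_congr rfl fun c _ => ?_
      rw [ih]
      congr 1
      exact blockMatrix_apply A _ c b
    · intro j _ hj
      refine Finset.sum_eq_zero fun c _ => ?_
      rw [(isCyclicBlock_blockMatrix A).pow_apply_eq_zero, zero_mul]
      rw [Fin.val_zero, zero_add, ← idx_val]
      exact Fin.val_ne_of_ne hj
    · simp

theorem blockMatrix_pow_submatrix (A : ∀ j : Fin d, Matrix (Fin (n j)) (Fin (n (j + 1))) R) :
    (blockMatrix A ^ d).submatrix (Sigma.mk 0) (Sigma.mk 0) = cyclicProd A := by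
  ext a b
  rw [cyclicProd, Matrix.submatrix_apply, Matrix.submatrix_apply, id, ← blockMatrix_pow_apply]
  -- Generalising `idx d d` to a variable `j` lets the cast be eliminated by substitution.
  have : ∀ (j : Fin d) (h : j = 0), (⟨0, b⟩ : Σ j, Fin (n j)) =
      ⟨j, Fin.cast (congrArg n h.symm) b⟩ := by
    rintro j rfl
    rfl
  exact congrArg _ (this _ (idx_self d))

theorem IsCyclicBlock.map {R' : Type*} [CommRing R'] (f : R →+* R')
    {M : Matrix (Σ j, Fin (n j)) (Σ j, Fin (n j)) R} (hM : IsCyclicBlock M) :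
    IsCyclicBlock (M.map f) := fun a b h => by rw [Matrix.map_apply, hM a b h, map_zero]

theorem det_blockDiag_add_blockMatrix
    (A : ∀ j : Fin d, Matrix (Fin (n j)) (Fin (n (j + 1))) R) :
    (Matrix.diagonal (blockDiag n (X : R[X])) + (blockMatrix A).map C).det =
      (-1) ^ (zeroBlock n)ᶜ.card * detXAdd (cyclicProd A) := by
  have h : ((blockMatrix A).map C) ^ d = (blockMatrix A ^ d).map (C : R →+* R[X]) := by
    simpa using ((C : R →+* R[X]).mapMatrix.map_pow (blockMatrix A) d).symm
  rw [det_blockDiag_add ((isCyclicBlock_blockMatrix A).map C), h, detXAdd,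
    ← blockMatrix_pow_submatrix]
  rfl

end Cyclic

/-! ### Blockwise counting of permutations making two sets disjoint -/

section Counting

/-- The permutations are fibred over the image of `U`, which may be any subset of `Tᶜ` of the same
size; all fibres are equally large. -/
theorem card_perm_disjoint {α : Type*} [Fintype α] [DecidableEq α] (U T : Finset α) :
    (Finset.univ.filter fun σ : Equiv.Perm α => Disjoint (U.map σ.toEmbedding) T).card =
      weight (Fintype.card α) (U.card + T.card) U.card := by
  rw [weight_eq _ _ _ (Finset.card_le_univ T),
    Finset.card_eq_sum_card_fiberwise (f := fun σ : Equiv.Perm α => U.map σ.toEmbedding)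
      (t := Tᶜ.powersetCard U.card)]
  · rw [Finset.sum_congr rfl (g := fun _ => U.card.factorial *
      (Fintype.card α - U.card).factorial)]
    · rw [Finset.sum_const, Finset.card_powersetCard, Finset.card_compl, smul_eq_mul, mul_comm]
    · intro S hS
      rw [Finset.mem_powersetCard] at hS
      rw [← card_perm_map_eq U S hS.2.symm, Finset.filter_filter]
      congr 1
      ext σ
      simp only [Finset.mem_filter, Finset.mem_univ, true_and, and_iff_right_iff_imp]
      rintro rfl
      exact Finset.subset_compl_iff_disjoint_right.1 hS.1
  · intro σ hσ
    simp only [Finset.coe_filter, Finset.mem_univ, true_and, Set.mem_ofPred_eq] at hσ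
    simp only [Finset.mem_coe, Finset.mem_powersetCard, Finset.card_map, and_true]
    exact Finset.subset_compl_iff_disjoint_right.2 hσ

variable {d : ℕ} {n : Fin d → ℕ}

/-- The part of `S` in the block `j`. -/
def slice (S : Finset (Σ j, Fin (n j))) (j : Fin d) : Finset (Fin (n j)) :=
  Finset.univ.filter fun a => ⟨j, a⟩ ∈ S

theorem mem_slice {S : Finset (Σ j, Fin (n j))} {j : Fin d} {a : Fin (n j)} :
    a ∈ slice S j ↔ ⟨j, a⟩ ∈ S := by
  simp [slice]

theorem filter_eq_map_slice (S : Finset (Σ j, Fin (n j))) (j : Fin d) :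
    S.filter (·.1 = j) = (slice S j).map (Function.Embedding.sigmaMk j) := by
  ext ⟨i, a⟩
  simp only [Finset.mem_filter, Finset.mem_map, mem_slice, Function.Embedding.sigmaMk_apply]
  constructor
  · rintro ⟨h, rfl⟩
    exact ⟨a, h, rfl⟩
  · rintro ⟨b, hb, h⟩
    obtain rfl : j = i := congrArg Sigma.fst h
    obtain rfl : b = a := by simpa using h
    exact ⟨hb, rfl⟩

theorem card_slice (S : Finset (Σ j, Fin (n j))) (j : Fin d) :
    (slice S j).card = blockCard S j := by
  rw [blockCard, filter_eq_map_slice, Finset.card_map]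

theorem slice_map (S : Finset (Σ j, Fin (n j))) (σ : ∀ j, Equiv.Perm (Fin (n j))) (j : Fin d) :
    slice (S.map (Equiv.sigmaCongrRight σ).toEmbedding) j = (slice S j).map (σ j).toEmbedding := by
  ext a
  rw [mem_slice, Finset.mem_map_equiv, Finset.mem_map_equiv, mem_slice]
  rfl

theorem disjoint_iff_slice (S T : Finset (Σ j, Fin (n j))) :
    Disjoint S T ↔ ∀ j, Disjoint (slice S j) (slice T j) := by
  simp only [Finset.disjoint_left, mem_slice]
  exact ⟨fun h j a => @h ⟨j, a⟩, fun h a => h a.1 (a := a.2)⟩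

theorem card_perms_disjoint (U T : Finset (Σ j, Fin (n j))) :
    (Finset.univ.filter fun σ : (∀ j, Equiv.Perm (Fin (n j))) =>
      Disjoint (U.map (Equiv.sigmaCongrRight σ).toEmbedding) T).card =
      ∏ j, weight (n j) (blockCard U j + blockCard T j) (blockCard U j) := by
  have h : (Finset.univ.filter fun σ : (∀ j, Equiv.Perm (Fin (n j))) =>
      Disjoint (U.map (Equiv.sigmaCongrRight σ).toEmbedding) T) =
      Fintype.piFinset fun j => Finset.univ.filter fun σ : Equiv.Perm (Fin (n j)) =>
        Disjoint ((slice U j).map σ.toEmbedding) (slice T j) := by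
    ext σ
    simp [disjoint_iff_slice, slice_map]
  rw [h, Fintype.card_piFinset]
  refine Finset.prod_congr rfl fun j _ => ?_
  rw [card_perm_disjoint, Fintype.card_fin, card_slice, card_slice]

theorem blockCard_map (S : Finset (Σ j, Fin (n j))) (σ : ∀ j, Equiv.Perm (Fin (n j)))
    (j : Fin d) :
    blockCard (S.map (Equiv.sigmaCongrRight σ).toEmbedding) j = blockCard S j := by
  rw [← card_slice, slice_map, Finset.card_map, card_slice]

theorem blockCard_compl (S : Finset (Σ j, Fin (n j))) (j : Fin d) :
    blockCard Sᶜ j + blockCard S j = n j := by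
  have h : slice Sᶜ j = (slice S j)ᶜ := by
    ext a
    simp [mem_slice]
  rw [← card_slice, ← card_slice, h, Finset.card_compl_add_card, Fintype.card_fin]

theorem blockCard_union {S T : Finset (Σ j, Fin (n j))} (h : Disjoint S T) (j : Fin d) :
    blockCard (S ∪ T) j = blockCard S j + blockCard T j := by
  rw [blockCard, Finset.filter_union,
    Finset.card_union_of_disjoint (Finset.disjoint_filter_filter h)]
  rfl

end Counting

/-! ### The average over block diagonal signed permutations -/

section

variable {R : Type*} [CommRing R] {d : ℕ} [NeZero d] {n : Fin d → ℕ}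

theorem card_compl_zeroBlock : (zeroBlock n)ᶜ.card = ∑ j ∈ Finset.univ.erase 0, n j := by
  rw [Finset.card_eq_sum_card_fiberwise (f := Sigma.fst) (t := Finset.univ.erase 0)]
  · refine Finset.sum_congr rfl fun j hj => ?_
    rw [← card_filter_fst (n := n) j]
    congr 1
    ext a
    simp only [Finset.mem_filter, mem_compl_zeroBlock, Finset.mem_univ, true_and,
      and_iff_right_iff_imp]
    rintro rfl
    exact Finset.ne_of_mem_erase hj
  · intro a ha
    simpa using mem_compl_zeroBlock.1 (Finset.mem_coe.1 ha)

/-- The product of the diagonal entries outside a set with `k` elements in each block. -/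
theorem prod_blockDiag_compl (x : R) (S : Finset (Σ j, Fin (n j))) (k : ℕ)
    (hS : ∀ j, blockCard S j = k) :
    ∏ a ∈ Sᶜ, blockDiag n x a =
      (-1) ^ (zeroBlock n)ᶜ.card * (x ^ (n 0 - k) * ((-1) ^ (d - 1)) ^ k) := by
  have hk : ∀ j, blockCard Sᶜ j + k = n j := fun j => by rw [← hS j, blockCard_compl]
  rw [← Finset.prod_fiberwise_of_maps_to (g := Sigma.fst) (t := Finset.univ)
    (fun _ _ => Finset.mem_univ _)]
  have h1 : ∀ j : Fin d, ∏ a ∈ Sᶜ.filter (·.1 = j), blockDiag n x a =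
      (if j = 0 then x else -1) ^ blockCard Sᶜ j := by
    intro j
    rw [blockCard, ← Finset.prod_const]
    refine Finset.prod_congr rfl fun a ha => ?_
    rw [blockDiag, (Finset.mem_filter.1 ha).2]
  simp_rw [h1]
  rw [← Finset.mul_prod_erase _ _ (Finset.mem_univ 0), if_pos rfl, card_compl_zeroBlock,
    ← Finset.prod_pow_eq_pow_sum]
  -- The exponent `n j - k` has the parity of `n j + k`, which separates the global sign from the
  -- factor depending on `k`.
  have h2 : ∀ j ∈ Finset.univ.erase (0 : Fin d),
      (if j = 0 then x else -1) ^ blockCard Sᶜ j = (-1) ^ n j * (-1) ^ k := by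
    intro j hj
    rw [if_neg (Finset.ne_of_mem_erase hj), ← hk j, ← pow_add, add_assoc, pow_add _ _ (k + k),
      Even.neg_one_pow ⟨k, rfl⟩, mul_one]
  rw [Finset.prod_congr rfl h2, Finset.prod_mul_distrib, Finset.prod_const,
    Finset.card_erase_of_mem (Finset.mem_univ _), Finset.card_univ, Fintype.card_fin,
    ← pow_mul, ← pow_mul, mul_comm k, ← hk 0, Nat.add_sub_cancel]
  ring

/-- The sum of the principal minors of `M` on sets with `i` elements in the block `0`. -/
def minorSum (M : Matrix (Σ j, Fin (n j)) (Σ j, Fin (n j)) R) (i : ℕ) : R :=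
  ∑ S : Finset (Σ j, Fin (n j)) with blockCard S 0 = i, principalMinor M S

theorem blockCard_zero_mem_range (S : Finset (Σ j, Fin (n j))) :
    blockCard S 0 ∈ Finset.range (n 0 + 1) := by
  rw [Finset.mem_range, ← blockCard_compl S 0]
  omega

theorem sum_principalMinor_mul (M : Matrix (Σ j, Fin (n j)) (Σ j, Fin (n j)) R) (h : ℕ → R) :
    ∑ S : Finset (Σ j, Fin (n j)), principalMinor M S * h (blockCard S 0) =
      ∑ i ∈ Finset.range (n 0 + 1), minorSum M i * h i := by
  rw [← Finset.sum_fiberwise_of_maps_to (g := fun S => blockCard S 0)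
    (fun S _ => blockCard_zero_mem_range S)]
  refine Finset.sum_congr rfl fun i _ => ?_
  rw [minorSum, Finset.sum_mul]
  exact Finset.sum_congr rfl fun S hS => by rw [(Finset.mem_filter.1 hS).2]

theorem det_blockDiag_add_eq_sum {M : Matrix (Σ j, Fin (n j)) (Σ j, Fin (n j)) R}
    (hM : IsCyclicBlock M) (x : R) :
    (Matrix.diagonal (blockDiag n x) + M).det = (-1) ^ (zeroBlock n)ᶜ.card *
      ∑ i ∈ Finset.range (n 0 + 1), minorSum M i * (x ^ (n 0 - i) * ((-1) ^ (d - 1)) ^ i) := by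
  rw [det_diagonal_add, ← sum_principalMinor_mul, Finset.mul_sum]
  refine Finset.sum_congr rfl fun S _ => ?_
  by_cases hS : principalMinor M S = 0
  · simp [hS]
  · rw [prod_blockDiag_compl x S _ (blockCard_eq hM hS)]
    ring

/-- When the images are disjoint, the union has `i + t` elements in every block, so the summand does
not depend on `σ` and only the count matters. -/
theorem sum_perms_prod_blockDiag (x : R) (U T : Finset (Σ j, Fin (n j))) (i t : ℕ)
    (hU : ∀ j, blockCard U j = i) (hT : ∀ j, blockCard T j = t) :
    ∑ σ : (∀ j, Equiv.Perm (Fin (n j))),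
      (if Disjoint (U.map (Equiv.sigmaCongrRight σ).toEmbedding) T then
        ∏ a ∈ (U.map (Equiv.sigmaCongrRight σ).toEmbedding ∪ T)ᶜ, blockDiag n x a else 0) =
      (-1) ^ (zeroBlock n)ᶜ.card * ((∏ j, (weight (n j) (i + t) i : R)) *
        (x ^ (n 0 - (i + t)) * ((-1) ^ (d - 1)) ^ (i + t))) := by
  rw [← Finset.sum_filter, Finset.sum_congr rfl (g := fun _ => (-1) ^ (zeroBlock n)ᶜ.card *
    (x ^ (n 0 - (i + t)) * ((-1) ^ (d - 1)) ^ (i + t)))]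
  · rw [Finset.sum_const, card_perms_disjoint, nsmul_eq_mul]
    simp_rw [hU, hT]
    push_cast
    ring
  · intro σ hσ
    apply prod_blockDiag_compl
    intro j
    rw [blockCard_union (Finset.mem_filter.1 hσ).2, blockCard_map, hU, hT]

/-- The sum of `det (y + U M U⁻¹ + N)` over block diagonal signed permutation matrices `U`. -/
theorem sum_det_signedPerm {M N : Matrix (Σ j, Fin (n j)) (Σ j, Fin (n j)) R}
    (hM : IsCyclicBlock M) (hN : IsCyclicBlock N) (x : R) :
    ∑ σ : (∀ j, Equiv.Perm (Fin (n j))), ∑ ε : (Σ j, Fin (n j)) → ℤˣ,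
      (Matrix.of (fun a b => (((ε a : ℤˣ) : ℤ) : R) * (((ε b : ℤˣ) : ℤ) : R) *
        M (Equiv.sigmaCongrRight σ a) (Equiv.sigmaCongrRight σ b)) +
          (Matrix.diagonal (blockDiag n x) + N)).det =
      (-1) ^ (zeroBlock n)ᶜ.card * (2 ^ (∑ j, n j) *
        ∑ i ∈ Finset.range (n 0 + 1), ∑ t ∈ Finset.range (n 0 + 1),
          minorSum M i * minorSum N t * ((∏ j, (weight (n j) (i + t) i : R)) *
            (x ^ (n 0 - (i + t)) * ((-1) ^ (d - 1)) ^ (i + t)))) := by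
  set g : Finset (Σ j, Fin (n j)) → R := fun S =>
    principalMinor (Matrix.diagonal (blockDiag n x) + N) Sᶜ with hg
  have hg' : ∀ S, g S = ∑ T, principalMinor N T *
      (if Disjoint S T then ∏ a ∈ (S ∪ T)ᶜ, blockDiag n x a else 0) := by
    intro S
    simp_rw [hg, principalMinor_diagonal_add, mul_ite, mul_zero]
    rw [← Finset.sum_filter]
    refine Finset.sum_congr ?_ fun T _ => ?_
    · ext T
      simp [Finset.subset_compl_iff_disjoint_right, disjoint_comm]
    · rw [Finset.compl_union, Finset.sdiff_eq_inter_compl]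
  have h1 : ∀ σ : (∀ j, Equiv.Perm (Fin (n j))), ∑ ε : (Σ j, Fin (n j)) → ℤˣ,
      (Matrix.of (fun a b => (((ε a : ℤˣ) : ℤ) : R) * (((ε b : ℤˣ) : ℤ) : R) *
        M (Equiv.sigmaCongrRight σ a) (Equiv.sigmaCongrRight σ b)) +
          (Matrix.diagonal (blockDiag n x) + N)).det =
      2 ^ (∑ j, n j) * ∑ U, principalMinor M U *
        g (U.map (Equiv.sigmaCongrRight σ⁻¹).toEmbedding) := by
    intro σ
    have := sum_det_signs (M.submatrix (Equiv.sigmaCongrRight σ).toEmbedding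
      (Equiv.sigmaCongrRight σ).toEmbedding) (Matrix.diagonal (blockDiag n x) + N)
    simp_rw [principalMinor_submatrix] at this
    refine this.trans ?_
    congr 1
    · simp
    -- Substituting `U = σ S` removes `σ` from the minor of `M`, at the cost of `σ⁻¹` in the
    -- complementary minor.
    · refine Fintype.sum_equiv (Equiv.finsetCongr (Equiv.sigmaCongrRight σ)) _ _ fun S => ?_
      rw [Equiv.finsetCongr_apply]
      congr 1
      simp only [hg]
      congr 2
      rw [Finset.map_map]
      ext a
      simp [Finset.mem_map, Equiv.sigmaCongrRight]
  simp_rw [h1]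
  rw [← Finset.mul_sum, Finset.sum_comm, mul_left_comm]
  congr 1
  simp_rw [← Finset.mul_sum, mul_assoc]
  simp_rw [← Finset.mul_sum]
  rw [← sum_principalMinor_mul M fun i => ∑ t ∈ Finset.range (n 0 + 1),
    minorSum N t * ((∏ j, (weight (n j) (i + t) i : R)) *
            (x ^ (n 0 - (i + t)) * ((-1) ^ (d - 1)) ^ (i + t))), Finset.mul_sum]
  refine Finset.sum_congr rfl fun U _ => ?_
  by_cases hU : principalMinor M U = 0
  · simp [hU]
  rw [mul_left_comm]
  congr 1
  rw [← sum_principalMinor_mul N fun t => (∏ j, (weight (n j) (blockCard U 0 + t)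
    (blockCard U 0) : R)) * (x ^ (n 0 - (blockCard U 0 + t)) *
      ((-1) ^ (d - 1)) ^ (blockCard U 0 + t)), Finset.mul_sum]
  refine (Equiv.sum_comp (Equiv.inv (∀ j, Equiv.Perm (Fin (n j))))
    fun σ => g (U.map (Equiv.sigmaCongrRight σ).toEmbedding)).trans ?_
  simp_rw [hg']
  rw [Finset.sum_comm]
  refine Finset.sum_congr rfl fun T _ => ?_
  by_cases hT : principalMinor N T = 0
  · simp [hT]
  rw [mul_left_comm, ← Finset.mul_sum]
  congr 1
  exact sum_perms_prod_blockDiag x U T _ _ (blockCard_eq hM hU) (blockCard_eq hN hT)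

/-! ### Translation back to the cyclic products -/

theorem signedPerm_apply {m : ℕ} (ε : Fin m → ℤˣ) (σ : Equiv.Perm (Fin m)) (a b : Fin m) :
    signedPerm R ε σ a b = if σ a = b then (((ε a : ℤˣ) : ℤ) : R) else 0 := by
  simp [signedPerm, signMatrix, Matrix.diagonal_mul, Equiv.Perm.permMatrix,
    PEquiv.toMatrix_apply]

theorem signedPerm_inv {m : ℕ} (ε : Fin m → ℤˣ) (σ : Equiv.Perm (Fin m)) :
    (signedPerm R ε σ)⁻¹ = (signedPerm R ε σ)ᵀ := by
  apply Matrix.inv_eq_right_inv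
  ext a b
  simp only [Matrix.mul_apply, Matrix.transpose_apply, signedPerm_apply, Matrix.one_apply,
    ite_mul, zero_mul, Finset.sum_ite_eq, Finset.mem_univ, if_true, EmbeddingLike.apply_eq_iff_eq]
  rcases eq_or_ne a b with rfl | h
  · rw [if_pos rfl, if_pos rfl, ← Int.cast_mul, ← Units.val_mul, Int.units_mul_self]
    simp
  · simp [h, h.symm]

theorem conj_signedPerm_apply {m l : ℕ} (ε : Fin m → ℤˣ) (σ : Equiv.Perm (Fin m))
    (ε' : Fin l → ℤˣ) (σ' : Equiv.Perm (Fin l)) (A : Matrix (Fin m) (Fin l) R)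
    (a : Fin m) (b : Fin l) :
    (signedPerm R ε σ * A * (signedPerm R ε' σ')⁻¹) a b =
      (((ε a : ℤˣ) : ℤ) : R) * (((ε' b : ℤˣ) : ℤ) : R) * A (σ a) (σ' b) := by
  rw [signedPerm_inv]
  simp [Matrix.mul_apply, signedPerm_apply]
  ring

theorem blockMatrix_twisted (A D : ∀ j : Fin d, Matrix (Fin (n j)) (Fin (n (j + 1))) R)
    (σ : ∀ j : Fin d, Equiv.Perm (Fin (n j))) (ε : ∀ j : Fin d, Fin (n j) → ℤˣ) :
    blockMatrix (fun j =>
      signedPerm R (ε j) (σ j) * A j * (signedPerm R (ε (j + 1)) (σ (j + 1)))⁻¹ + D j) =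
    Matrix.of (fun a b : Σ j, Fin (n j) =>
      (((ε a.1 a.2 : ℤˣ) : ℤ) : R) * (((ε b.1 b.2 : ℤˣ) : ℤ) : R) *
        blockMatrix A (Equiv.sigmaCongrRight σ a) (Equiv.sigmaCongrRight σ b)) +
      blockMatrix D := by
  ext ⟨i, a⟩ ⟨j, b⟩
  by_cases h : j = i + 1
  · subst h
    rw [Matrix.add_apply, blockMatrix_apply, blockMatrix_apply, Matrix.add_apply,
      conj_signedPerm_apply]
    simp only [Matrix.of_apply, Equiv.sigmaCongrRight_apply]
    rw [blockMatrix_apply]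
  · simp [blockMatrix, h]

theorem minorSum_map {R' : Type*} [CommRing R'] (f : R →+* R')
    (M : Matrix (Σ j, Fin (n j)) (Σ j, Fin (n j)) R) (i : ℕ) :
    minorSum (M.map f) i = f (minorSum M i) := by
  simp [minorSum, principalMinor_map]

/-- Block elimination and minor expansion evaluate the same determinant; their common sign is a unit
and cancels. -/
theorem detXAdd_cyclicProd (A : ∀ j : Fin d, Matrix (Fin (n j)) (Fin (n (j + 1))) R) :
    detXAdd (cyclicProd A) = ∑ i ∈ Finset.range (n 0 + 1), (X : R[X]) ^ (n 0 - i) *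
      C (((-1) ^ (d - 1)) ^ i * minorSum (blockMatrix A) i) := by
  have h := det_blockDiag_add_blockMatrix A
  rw [det_blockDiag_add_eq_sum ((isCyclicBlock_blockMatrix A).map C)] at h
  rw [← (isUnit_neg_one.pow _).mul_left_cancel h]
  refine Finset.sum_congr rfl fun i _ => ?_
  rw [minorSum_map]
  simp only [C_mul, C_pow, C_neg, C_1]
  ring

theorem sum_detXAdd_twistedProd
    (A D : ∀ j : Fin d, Matrix (Fin (n j)) (Fin (n (j + 1))) R) :
    ∑ σ : (∀ j : Fin d, Equiv.Perm (Fin (n j))), ∑ ε : (∀ j : Fin d, Fin (n j) → ℤˣ),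
        detXAdd (twistedProd A D σ ε) =
      ∑ i ∈ Finset.range (n 0 + 1), ∑ t ∈ Finset.range (n 0 + 1),
        (X : R[X]) ^ (n 0 - (i + t)) * C (2 ^ (∑ j, n j) *
          ((∏ j, (weight (n j) (i + t) i : R)) *
            (((-1) ^ (d - 1)) ^ i * minorSum (blockMatrix A) i) *
            (((-1) ^ (d - 1)) ^ t * minorSum (blockMatrix D) t))) := by
  have hη : IsUnit ((-1 : R[X]) ^ (zeroBlock n)ᶜ.card) := isUnit_neg_one.pow _
  apply hη.mul_left_cancel
  have h := sum_det_signedPerm ((isCyclicBlock_blockMatrix A).map (C : R →+* R[X]))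
    ((isCyclicBlock_blockMatrix D).map C) X
  refine Eq.trans ?_ (h.trans ?_)
  · rw [Finset.mul_sum]
    refine Finset.sum_congr rfl fun σ _ => ?_
    rw [Finset.mul_sum]
    -- A family of sign vectors is one sign vector on the disjoint union.
    refine Fintype.sum_equiv (Equiv.piCurry fun _ _ => ℤˣ).symm _ _ fun ε => ?_
    rw [twistedProd, ← det_blockDiag_add_blockMatrix, blockMatrix_twisted, add_left_comm]
    congr 2
    ext a b : 2
    simp [Equiv.piCurry, Sigma.uncurry, add_comm]
  · congr 1
    rw [Finset.mul_sum]
    refine Finset.sum_congr rfl fun i _ => ?_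
    rw [Finset.mul_sum]
    refine Finset.sum_congr rfl fun t _ => ?_
    rw [minorSum_map, minorSum_map]
    simp only [C_mul, C_pow, C_neg, C_1, map_prod, map_natCast, C_ofNat]
    ring

theorem coeff_sum_X_pow_sub (N : ℕ) (f : ℕ → R) {k : ℕ} (hk : k ≤ N) :
    (∑ i ∈ Finset.range (N + 1), (X : R[X]) ^ (N - i) * C (f i)).coeff (N - k) = f k := by
  simp only [finsetSum_coeff, coeff_mul_C, coeff_X_pow, ite_mul, one_mul, zero_mul]
  rw [Finset.sum_eq_single_of_mem k (Finset.mem_range.2 (by omega)), if_pos rfl]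
  intro i hi hik
  rw [Finset.mem_range] at hi
  exact if_neg (by omega)

end

end CyclicSum

/-! ### Comparison of coefficients -/

theorem mainTheorem3 {K : Type*} [CommRing K] (d : ℕ) [NeZero d] (n : Fin d → ℕ)
    (A D : ∀ j : Fin d, Matrix (Fin (n j)) (Fin (n (j + 1))) K) (p q r : ℕ → K)
    (hp : CyclicSum.detXAdd (CyclicSum.cyclicProd A) =
      ∑ i ∈ Finset.range (n 0 + 1), (X : K[X]) ^ (n 0 - i) * C (p i))
    (hq : CyclicSum.detXAdd (CyclicSum.cyclicProd D) =
      ∑ i ∈ Finset.range (n 0 + 1), (X : K[X]) ^ (n 0 - i) * C (q i))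
    (hr : ∑ σ : (∀ j : Fin d, Equiv.Perm (Fin (n j))), ∑ ε : (∀ j : Fin d, Fin (n j) → ℤˣ),
        CyclicSum.detXAdd (CyclicSum.twistedProd A D σ ε) =
      ∑ i ∈ Finset.range (n 0 + 1), (X : K[X]) ^ (n 0 - i) * C (r i))
    (k : ℕ) (hk : k ≤ n 0) :
    r k = (1 + 1) ^ (∑ j, n j) *
      ∑ i ∈ Finset.range (k + 1),
        (∏ j, (CyclicSum.weight (n j) k i : K)) * p i * q (k - i) := by
  have hp' : ∀ i ≤ n 0, ((-1) ^ (d - 1)) ^ i *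
      CyclicSum.minorSum (CyclicSum.blockMatrix A) i = p i := fun i hi => by
    rw [← CyclicSum.coeff_sum_X_pow_sub (n 0) p hi, ← hp, CyclicSum.detXAdd_cyclicProd,
      CyclicSum.coeff_sum_X_pow_sub _ _ hi]
  have hq' : ∀ i ≤ n 0, ((-1) ^ (d - 1)) ^ i *
      CyclicSum.minorSum (CyclicSum.blockMatrix D) i = q i := fun i hi => by
    rw [← CyclicSum.coeff_sum_X_pow_sub (n 0) q hi, ← hq, CyclicSum.detXAdd_cyclicProd,
      CyclicSum.coeff_sum_X_pow_sub _ _ hi]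
  -- For `i + t > n 0` the exponent `n 0 - (i + t)` truncates to 0 and would pollute the coefficient
  -- with `k = n 0`; the weight of block 0 removes these terms.
  have hw : ∀ i t, n 0 < i + t → ∏ j, (CyclicSum.weight (n j) (i + t) i : K) = 0 := fun i t h =>
    Finset.prod_eq_zero (Finset.mem_univ 0) (by simp [CyclicSum.weight, h])
  rw [← CyclicSum.coeff_sum_X_pow_sub (n 0) r hk, ← hr, CyclicSum.sum_detXAdd_twistedProd,
    one_add_one_eq_two, Finset.mul_sum]
  simp only [finsetSum_coeff, coeff_mul_C, coeff_X_pow, ite_mul, one_mul, zero_mul]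
  have hterm : ∀ i ∈ Finset.range (n 0 + 1), ∀ t ∈ Finset.range (n 0 + 1),
      (if n 0 - k = n 0 - (i + t) then (2 : K) ^ (∑ j, n j) *
        ((∏ j, (CyclicSum.weight (n j) (i + t) i : K)) *
          (((-1) ^ (d - 1)) ^ i * CyclicSum.minorSum (CyclicSum.blockMatrix A) i) *
          (((-1) ^ (d - 1)) ^ t * CyclicSum.minorSum (CyclicSum.blockMatrix D) t)) else 0) =
      if i + t = k then (2 : K) ^ (∑ j, n j) *
        ((∏ j, (CyclicSum.weight (n j) k i : K)) * p i * q t) else 0 := by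
    intro i hi t ht
    rw [Finset.mem_range] at hi ht
    rw [hp' i (by omega), hq' t (by omega)]
    by_cases h : i + t = k
    · rw [if_pos h, if_pos (by rw [h]), h]
    · rw [if_neg h]
      split_ifs with h'
      · rw [hw i t (by omega)]
        simp
      · rfl
  rw [Finset.sum_congr rfl fun i hi => Finset.sum_congr rfl (hterm i hi)]
  symm
  refine Finset.sum_subset_zero_on_sdiff (Finset.range_subset_range.2 (by omega)) ?_ ?_
  · intro i hi
    rw [Finset.mem_sdiff, Finset.mem_range, Finset.mem_range] at hi
    exact Finset.sum_eq_zero fun t _ => if_neg (by omega)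
  · intro i hi
    rw [Finset.mem_range] at hi
    rw [Finset.sum_eq_single_of_mem (k - i) (Finset.mem_range.2 (by omega)), if_pos (by omega)]
    intro t _ ht
    exact if_neg (by omega)
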